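/- Let a group $G$ act by homeomorphisms on a topological space $X$. Suppose that $X$ is 1-connected, i.e. nonempty, path connected and with trivial fundamental group. Let $U\subseteq X$ be an open, path connected subset such that $X=\bigcup_{g\in G} gU$. Let $N$ be the nerve of the covering $(gU)_{g\in G}$, that is, the abstract simplicial complex with vertex set $G$ in which a nonempty finite subset $\sigma\subseteq G$ spans a simplex if and only if $\bigcap_{g\in\sigma} gU\neq\emptyset$. Then the geometric realization $|N|$, equipped with the weak topology (a subset is open if and only if its intersection with every closed simplex is open in that simplex), is 1-connected. -/

import Mathlib

open scoped Pointwise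

/-- The nerve of a family of sets `A i`, `i : ι`: a nonempty finite set `σ` of indices spans a
simplex iff the sets `A i`, `i ∈ σ`, have a common point. -/
def coverNerve {ι X : Type*} (A : ι → Set X) : PreAbstractSimplicialComplex ι where
  faces := {σ | σ.Nonempty ∧ (⋂ i ∈ σ, A i).Nonempty}
  isRelLowerSet_faces := by
    rintro σ ⟨hσ, x, hx⟩
    refine ⟨hσ, fun τ hτσ hτ => ⟨hτ, x, ?_⟩⟩
    simp only [Set.mem_iInter] at hx ⊢
    exact fun i hi => hx i (hτσ hi)

/-- If the sets `A i` are nonempty, the vertex set of the nerve is the whole index type. -/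
theorem singleton_mem_coverNerve {ι X : Type*} (A : ι → Set X) (hA : ∀ i, (A i).Nonempty)
    (i : ι) : ({i} : Finset ι) ∈ (coverNerve A).faces := by
  refine ⟨Finset.singleton_nonempty i, ?_⟩
  simpa using hA i

/-- The geometric realization of an abstract simplicial complex, as a set: its points are the
systems of barycentric coordinates whose support is a simplex. -/
@[ext]
structure GeometricRealization {ι : Type*} (K : PreAbstractSimplicialComplex ι) where
  /-- the barycentric coordinates -/
  coord : ι →₀ ℝ
  support_mem : coord.support ∈ K.faces
  nonneg : ∀ i, 0 ≤ coord i
  sum_eq_one : (coord.sum fun _ a => a) = 1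

namespace GeometricRealization

/-- The characteristic map of the simplex `σ`, from the standard simplex with vertex set `σ` to
the realization: barycentric coordinates are extended by zero. -/
noncomputable def faceMap {ι : Type*} (K : PreAbstractSimplicialComplex ι) (σ : K.faces)
    (t : stdSimplex ℝ σ.1) : GeometricRealization K where
  coord := (Finsupp.equivFunOnFinite.symm t.1).embDomain (Function.Embedding.subtype (· ∈ σ.1))
  sum_eq_one := by
    rw [Finsupp.sum_embDomain, Finsupp.sum_fintype _ _ (fun _ => rfl)]
    exact t.2.2
  support_mem := by
    refine (K.isRelLowerSet_faces σ.2).2 ?_ ?_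
    · intro i hi
      rw [Finsupp.support_embDomain, Finset.mem_map] at hi
      obtain ⟨j, -, rfl⟩ := hi
      exact j.2
    · rw [Finsupp.support_nonempty_iff]
      intro h
      rw [Finsupp.embDomain_eq_zero] at h
      have h1 : ∑ i, t.1 i = 1 := t.2.2
      have h0 : ∑ i, t.1 i = 0 := Finset.sum_eq_zero fun i _ => DFunLike.congr_fun h i
      exact zero_ne_one (h0.symm.trans h1)
  nonneg i := by
    by_cases hi : i ∈ σ.1
    · have := Finsupp.embDomain_apply_self (Function.Embedding.subtype (· ∈ σ.1))
        (Finsupp.equivFunOnFinite.symm t.1) ⟨i, hi⟩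
      exact (t.2.1 ⟨i, hi⟩).trans_eq this.symm
    · rw [Finsupp.embDomain_of_notMem_range]
      rintro ⟨j, rfl⟩
      exact hi j.2

/-- The weak topology: a subset of the realization is open iff its preimage in every closed
simplex is open. Simplices carry the Euclidean topology. -/
noncomputable instance {ι : Type*} (K : PreAbstractSimplicialComplex ι) :
    TopologicalSpace (GeometricRealization K) :=
  ⨆ σ : K.faces, TopologicalSpace.coinduced (faceMap K σ) inferInstance

theorem isOpen_iff {ι : Type*} (K : PreAbstractSimplicialComplex ι)
    (s : Set (GeometricRealization K)) :
    IsOpen s ↔ ∀ σ : K.faces, IsOpen (faceMap K σ ⁻¹' s) := by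
  simp only [isOpen_iSup_iff, isOpen_coinduced]

end GeometricRealization

/-! The open stars of the vertices cover `|N|`. A finite intersection of them is the open star of a
simplex or empty, an open star is contractible, and stars meet exactly when the corresponding
translates of `U` do (`openStar_nonempty_iff`). Choose a point in each star. Passing from one chosen
point to another inside two meeting stars gives a well-defined class in the fundamental groupoid,
and these classes satisfy the cocycle identity whenever three stars meet. Fixing a base point turns
them into a cocycle with values in `π₁(|N|)`. Since only the nerve matters, it is also a cocycle on
the covering of `X`, where it defines a principal covering space. As `X` is simply connected this
covering is trivial, so the cocycle is a coboundary (`exists_coboundary_of_cocycle`); intersections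
in `X` need not be connected for this. The coboundary selects a class from the base point to every
point of `|N|`, compatible with short paths and hence with all paths (`Path.comp_toHom_eq`). Any two
paths with the same end points are therefore homotopic. -/

/-! ### Covering spaces and cocycles -/

open unitInterval in
/-- Over a simply connected base, two points of a covering space which lie in the same fibre and can
be joined by a path are equal. -/
theorem IsCoveringMap.eq_of_joined {E X : Type*} [TopologicalSpace E] [TopologicalSpace X]
    [SimplyConnectedSpace X] {p : E → X} (cov : IsCoveringMap p) {a b : E} (h : Joined a b)
    (hab : p a = p b) : a = b := by
  obtain ⟨γ⟩ := h
  let δ : Path (p a) (p a) := (γ.map cov.continuous).cast rfl hab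
  have hδ : Path.Homotopic (Path.refl (p a)) δ := SimplyConnectedSpace.paths_homotopic _ _
  have h1 := cov.liftPath_apply_one_eq_of_homotopicRel hδ a (by simp) (by simp)
  have h2 : (γ : C(I, E)) = cov.liftPath δ.toContinuousMap a (by simp) :=
    (cov.eq_liftPath_iff' _).2 ⟨rfl, γ.source⟩
  have h3 : ContinuousMap.const I a = cov.liftPath (Path.refl (p a)).toContinuousMap a (by simp) :=
    (cov.eq_liftPath_iff' _).2 ⟨rfl, rfl⟩
  rw [← h2, ← h3] at h1
  simpa using h1

section Cocycle

variable {X ι Γ : Type*} [TopologicalSpace X] [Group Γ] [TopologicalSpace Γ] [DiscreteTopology Γ]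

/-- The principal bundle defined by a locally constant cocycle `g` on an open covering `A`. -/
def cocycleBundle (A : ι → Set X) (hA : ∀ i, IsOpen (A i)) (idx : X → ι)
    (hidx : ∀ x, x ∈ A (idx x)) (g : ι → ι → Γ)
    (hg : ∀ i j k, (A i ∩ A j ∩ A k).Nonempty → g i j * g j k = g i k) :
    FiberBundleCore ι X Γ where
  baseSet := A
  isOpen_baseSet := hA
  indexAt := idx
  mem_baseSet_at := hidx
  coordChange i j _ v := v * g i j
  coordChange_self i x hx v := by
    have := hg i i i ⟨x, ⟨hx, hx⟩, hx⟩
    rw [mul_eq_right] at this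
    rw [this, mul_one]
  continuousOn_coordChange i j :=
    ((continuous_of_discreteTopology (f := fun v : Γ => v * g i j)).comp
      continuous_snd).continuousOn
  coordChange_comp i j k x hx v := by
    rw [mul_assoc, hg i j k ⟨x, hx⟩]

theorem FiberBundle.isCoveringMap_proj {B F : Type*} [TopologicalSpace B] [TopologicalSpace F]
    [DiscreteTopology F] (E : B → Type*) [∀ b, TopologicalSpace (E b)]
    [TopologicalSpace (Bundle.TotalSpace F E)] [FiberBundle F E] :
    IsCoveringMap (Bundle.TotalSpace.proj : Bundle.TotalSpace F E → B) :=
  IsCoveringMap.mk _ (fun _ => F) (fun b => trivializationAt F E b)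
    (fun b => mem_baseSet_trivializationAt F E b)

end Cocycle

/-- On a simply connected space, a locally constant cocycle on an open covering by path connected
sets is a coboundary. -/
theorem exists_coboundary_of_cocycle {X ι Γ : Type*} [TopologicalSpace X] [SimplyConnectedSpace X]
    [Group Γ] (A : ι → Set X) (hAo : ∀ i, IsOpen (A i)) (hAp : ∀ i, IsPathConnected (A i))
    (hA : ⋃ i, A i = Set.univ) (g : ι → ι → Γ)
    (hg : ∀ i j k, (A i ∩ A j ∩ A k).Nonempty → g i j * g j k = g i k) :
    ∃ h : ι → Γ, ∀ i j, (A i ∩ A j).Nonempty → h i * g i j = h j := by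
  let _ : TopologicalSpace Γ := ⊥
  have : DiscreteTopology Γ := ⟨rfl⟩
  choose idx hidx using fun x => Set.mem_iUnion.1 (hA.symm ▸ Set.mem_univ x : x ∈ ⋃ i, A i)
  let Z := cocycleBundle A hAo idx hidx g hg
  have cov : IsCoveringMap Z.proj := FiberBundle.isCoveringMap_proj Z.Fiber
  -- The section with constant value `v` in chart `i`, rewritten in the preferred chart at `x`.
  let sec (i : ι) (v : Γ) (x : X) : Z.TotalSpace := ⟨x, v * g i (idx x)⟩
  have hsec (i : ι) (v : Γ) : ContinuousOn (sec i v) (A i) := by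
    have h1 : ContinuousOn (Z.localTriv i).toOpenPartialHomeomorph.symm (A i ×ˢ Set.univ) :=
      (Z.localTriv i).continuousOn_invFun
    exact h1.comp (f := fun x : X => (x, v))
      (by fun_prop) (fun x hx => ⟨hx, Set.mem_univ _⟩)
  have hjoin (i : ι) (v : Γ) {x y : X} (hx : x ∈ A i) (hy : y ∈ A i) :
      Joined (sec i v x) (sec i v y) := by
    obtain ⟨γ, hγ⟩ := (hAp i).joinedIn x hx y hy
    exact ⟨γ.map' ((hsec i v).mono (Set.range_subset_iff.2 hγ))⟩
  obtain ⟨x₀⟩ : Nonempty X := inferInstance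
  let e₀ : Z.TotalSpace := ⟨x₀, (1 : Γ)⟩
  -- The path component of `e₀` is the image of a global section; its constant value in chart `i`
  -- will be `h i`.
  have key (i : ι) : ∃ v : Γ, ∀ x ∈ A i, Joined e₀ (sec i v x) := by
    obtain ⟨y, hy⟩ := (hAp i).nonempty
    let γ : Path x₀ y := PathConnectedSpace.somePath x₀ y
    let L := cov.liftPath γ e₀ γ.source
    have hL : (L 1).proj = y :=
      (congr_fun (cov.liftPath_lifts γ e₀ γ.source) 1).trans γ.target
    have hJ : Joined e₀ (L 1) := ⟨⟨L, cov.liftPath_zero .., rfl⟩⟩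
    generalize L 1 = e at hL hJ
    obtain ⟨z, v⟩ := e
    obtain rfl : z = y := hL
    change Γ at v
    refine ⟨v * g (idx z) i, fun x hx => hJ.trans ?_⟩
    have : (⟨z, v⟩ : Z.TotalSpace) = sec i (v * g (idx z) i) z := by
      exact congrArg (Bundle.TotalSpace.mk (E := Z.Fiber) z)
        ((Z.coordChange_comp (idx z) i (idx z) z ⟨⟨hidx z, hy⟩, hidx z⟩ v).trans
          (Z.coordChange_self _ _ (hidx z) v)).symm
    rw [this]
    exact hjoin i _ hy hx
  choose h hh using key
  refine ⟨h, fun i j ⟨x, hi, hj⟩ => ?_⟩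
  have h1 : sec i (h i) x = sec j (h j) x :=
    cov.eq_of_joined ((hh i x hi).symm.trans (hh j x hj)) rfl
  have h2 : h i * g i (idx x) = h j * g j (idx x) := by injection h1
  rw [← hg i j (idx x) ⟨x, ⟨hi, hj⟩, hidx x⟩, ← mul_assoc] at h2
  exact mul_right_cancel h2

/-! ### Paths in the fundamental groupoid -/

section Groupoid
open CategoryTheory

/-- In a simply connected subset, all paths with given end points are homotopic. -/
theorem IsSimplyConnected.homotopic {Y : Type*} [TopologicalSpace Y] {S : Set Y}
    (hS : IsSimplyConnected S) {p q : Y} (γ γ' : Path p q) (h : ∀ t, γ t ∈ S) (h' : ∀ t, γ' t ∈ S) :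
    γ.Homotopic γ' := by
  have := hS.simplyConnectedSpace
  have hp : p ∈ S := by simpa using h 0
  have hq : q ∈ S := by simpa using h 1
  let δ : Path (⟨p, hp⟩ : S) ⟨q, hq⟩ :=
    ⟨⟨fun t => ⟨γ t, h t⟩, by fun_prop⟩, by simp, by simp⟩
  let δ' : Path (⟨p, hp⟩ : S) ⟨q, hq⟩ :=
    ⟨⟨fun t => ⟨γ' t, h' t⟩, by fun_prop⟩, by simp, by simp⟩
  exact (SimplyConnectedSpace.paths_homotopic δ δ').map ⟨Subtype.val, continuous_subtype_val⟩

variable {Y : Type*} [TopologicalSpace Y] {S T : Set Y}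

/-- The class of a path, as a morphism of the fundamental groupoid. -/
def Path.toHom {p q : Y} (γ : Path p q) :
    FundamentalGroupoid.mk p ⟶ FundamentalGroupoid.mk q :=
  Path.Homotopic.Quotient.mk γ

theorem Path.toHom_eq_iff {p q : Y} {γ γ' : Path p q} : γ.toHom = γ'.toHom ↔ γ.Homotopic γ' :=
  Path.Homotopic.Quotient.eq

theorem Path.toHom_trans {p q r : Y} (γ : Path p q) (γ' : Path q r) :
    (γ.trans γ').toHom = γ.toHom ≫ γ'.toHom :=
  Path.Homotopic.Quotient.mk_trans γ γ'

theorem Path.toHom_symm {p q : Y} (γ : Path p q) :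
    γ.symm.toHom = CategoryTheory.inv γ.toHom := by
  rw [← Groupoid.inv_eq_inv]
  rfl

/-- The class of the paths from `p` to `q` which lie in a path connected subset. -/
noncomputable def IsPathConnected.hom (hS : IsPathConnected S) {p q : Y} (hp : p ∈ S)
    (hq : q ∈ S) : FundamentalGroupoid.mk p ⟶ FundamentalGroupoid.mk q :=
  (hS.joinedIn p hp q hq).somePath.toHom

theorem IsSimplyConnected.hom_eq (hS : IsSimplyConnected S) {p q : Y} (hp : p ∈ S)
    (hq : q ∈ S) (γ : Path p q) (h : ∀ t, γ t ∈ S) :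
    hS.isPathConnected.hom hp hq = γ.toHom :=
  Path.toHom_eq_iff.2
    (hS.homotopic _ _ (hS.isPathConnected.joinedIn p hp q hq).somePath_mem h)

theorem IsSimplyConnected.hom_comp (hS : IsSimplyConnected S) {p q r : Y} (hp : p ∈ S)
    (hq : q ∈ S) (hr : r ∈ S) :
    hS.isPathConnected.hom hp hq ≫ hS.isPathConnected.hom hq hr = hS.isPathConnected.hom hp hr := by
  rw [IsPathConnected.hom, IsPathConnected.hom, ← Path.toHom_trans, ← hS.hom_eq hp hr]
  intro t
  rw [Path.trans_apply]
  split_ifs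
  exacts [(hS.isPathConnected.joinedIn p hp q hq).somePath_mem _,
    (hS.isPathConnected.joinedIn q hq r hr).somePath_mem _]

theorem IsSimplyConnected.hom_self (hS : IsSimplyConnected S) {p : Y} (hp : p ∈ S) :
    hS.isPathConnected.hom hp hp = 𝟙 _ :=
  hS.hom_eq hp hp (Path.refl p) fun _ => hp

theorem IsSimplyConnected.hom_eq_of_subset (hS : IsSimplyConnected S) (hT : IsPathConnected T)
    (hTS : T ⊆ S) {p q : Y} (hp : p ∈ T) (hq : q ∈ T) :
    hS.isPathConnected.hom (hTS hp) (hTS hq) = hT.hom hp hq :=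
  hS.hom_eq _ _ _ fun t => hTS ((hT.joinedIn p hp q hq).somePath_mem t)

open unitInterval in
/-- If the morphisms `D q` trivialize the fundamental groupoid locally, then they trivialize it on
every path. -/
theorem Path.comp_toHom_eq {y₀ : Y}
    (D : ∀ q : Y, FundamentalGroupoid.mk y₀ ⟶ FundamentalGroupoid.mk q)
    (hD : ∀ q : Y, ∃ V ∈ nhds q, ∀ (a b : Y) (γ : Path a b), (∀ t, γ t ∈ V) → D a ≫ γ.toHom = D b)
    {p q : Y} (γ : Path p q) : D p ≫ γ.toHom = D q := by
  have main (s t : I) : D (γ s) ≫ (γ.subpath s t).toHom = D (γ t) := by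
    let P : I → I → Prop := fun s t => D (γ s) ≫ (γ.subpath s t).toHom = D (γ t)
    have : Std.Symm P := ⟨fun s t h => by
      change _ ≫ _ = _ at h ⊢
      rw [← h, ← Path.symm_subpath, Path.toHom_symm, Category.assoc, IsIso.inv_hom_id,
        Category.comp_id]⟩
    refine PreconnectedSpace.induction₂ P (fun s => ?_) ⟨fun a b c hab hbc => ?_⟩ s t
    · obtain ⟨V, hV, hVD⟩ := hD (γ s)
      -- For `t` near `s` the whole interval between them is mapped into `V`.
      have h1 : Filter.Tendsto (fun t : I => Set.uIcc s t) (nhds s) (nhds s).smallSets :=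
        tendsto_const_nhds.uIcc Filter.tendsto_id
      have h2 := h1.eventually
        (Filter.eventually_smallSets_subset.2 (γ.continuous.continuousAt.preimage_mem_nhds hV))
      filter_upwards [h2] with t ht
      refine hVD _ _ _ fun r => ?_
      have : γ.subpath s t r ∈ Set.range (γ.subpath s t) := ⟨r, rfl⟩
      rw [Path.range_subpath] at this
      obtain ⟨u, hu, hur⟩ := this
      exact hur ▸ ht hu
    · change _ ≫ _ = _ at hab hbc ⊢
      rw [← hbc, ← hab, Category.assoc, ← Path.toHom_trans,
        Path.toHom_eq_iff.2 ⟨Path.Homotopy.subpathTransSubpath γ a b c⟩]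
  -- This concerns a path from `γ 0` to `γ 1`, which equal `p` and `q` only propositionally; the
  -- rest transports it to `γ`.
  have h := main 0 1
  generalize hδ : γ.subpath 0 1 = δ at h
  have hγ : ∀ t, δ t = γ t := by
    intro t; rw [← hδ, Path.subpath_zero_one]; rfl
  clear hδ
  have h0 := γ.source
  have h1 := γ.target
  generalize γ 0 = a at *
  generalize γ 1 = b at *
  subst h0 h1
  rwa [Path.ext (funext hγ)] at h

end Groupoid

/-! ### Comparison of two coverings with the same nerve -/

open CategoryTheory in
/-- Let `X` be simply connected with an open covering by path connected sets `A i`, and let `Y` have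
an open covering by simply connected sets `W i` with the same index set and path connected double
intersections. If both coverings have the same nerve up to dimension two, then `Y` is simply
connected. -/
theorem simplyConnectedSpace_of_cover {ι X Y : Type*} [TopologicalSpace X] [SimplyConnectedSpace X]
    [TopologicalSpace Y] (A : ι → Set X) (W : ι → Set Y)
    (hAo : ∀ i, IsOpen (A i)) (hAp : ∀ i, IsPathConnected (A i)) (hA : ⋃ i, A i = Set.univ)
    (hWo : ∀ i, IsOpen (W i)) (hWs : ∀ i, IsSimplyConnected (W i)) (hW : ⋃ i, W i = Set.univ)
    (hWp : ∀ i j, (W i ∩ W j).Nonempty → IsPathConnected (W i ∩ W j))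
    (hAW : ∀ i j k, (A i ∩ A j ∩ A k).Nonempty → (W i ∩ W j ∩ W k).Nonempty)
    (hWA : ∀ i j, (W i ∩ W j).Nonempty → (A i ∩ A j).Nonempty) :
    SimplyConnectedSpace Y := by
  have hAW' (i j : ι) (h : (A i ∩ A j).Nonempty) : (W i ∩ W j).Nonempty :=
    (hAW i j j (by rwa [Set.inter_assoc, Set.inter_self])).mono Set.inter_subset_left
  have memA (x : X) : ∃ i, x ∈ A i := Set.mem_iUnion.1 (hA.symm ▸ Set.mem_univ x)
  have memW (y : Y) : ∃ i, y ∈ W i := Set.mem_iUnion.1 (hW.symm ▸ Set.mem_univ y)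
  have hjoin (i : ι) {p q : Y} (hp : p ∈ W i) (hq : q ∈ W i) : Joined p q :=
    ((hWs i).isPathConnected.joinedIn p hp q hq).joined
  choose p hp using fun i => (hWs i).nonempty
  obtain ⟨x₀⟩ : Nonempty X := inferInstance
  obtain ⟨i₀, -⟩ := memA x₀
  -- path connectedness
  have hpp (i j : ι) : Joined (p i) (p j) := by
    let P : X → X → Prop := fun x x' => ∀ i j, x ∈ A i → x' ∈ A j → Joined (p i) (p j)
    have hloc {i j : ι} (h : (A i ∩ A j).Nonempty) : Joined (p i) (p j) := by
      obtain ⟨y, hi, hj⟩ := hAW' i j h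
      exact (hjoin i (hp i) hi).trans (hjoin j hj (hp j))
    have : Std.Symm P := ⟨fun x x' h i j hi hj => (h j i hj hi).symm⟩
    obtain ⟨x, hx⟩ := (hAp i).nonempty
    obtain ⟨x', hx'⟩ := (hAp j).nonempty
    refine PreconnectedSpace.induction₂ P (fun x => ?_) ⟨fun a b c hab hbc i j hi hj => ?_⟩ x x'
      i j hx hx'
    · obtain ⟨k, hk⟩ := memA x
      filter_upwards [(hAo k).mem_nhds hk] with x' hk' i j hi hj
      exact (hloc ⟨x, hi, hk⟩).trans (hloc ⟨x', hk', hj⟩)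
    · obtain ⟨k, hk⟩ := memA b
      exact (hab i k hi hk).trans (hbc k j hk hj)
  have hY : PathConnectedSpace Y := by
    refine ⟨⟨p i₀⟩, fun y y' => ?_⟩
    obtain ⟨i, hi⟩ := memW y
    obtain ⟨j, hj⟩ := memW y'
    exact ((hjoin i hi (hp i)).trans (hpp i j)).trans (hjoin j (hp j) hj)
  -- the transition morphisms
  let c (i : ι) {p q : Y} (hp : p ∈ W i) (hq : q ∈ W i) :=
    (hWs i).isPathConnected.hom hp hq
  have c_comp (i : ι) {p q r : Y} (hp : p ∈ W i) (hq : q ∈ W i) (hr : r ∈ W i) :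
      c i hp hq ≫ c i hq hr = c i hp hr := (hWs i).hom_comp hp hq hr
  have c_self (i : ι) {p : Y} (hp : p ∈ W i) : c i hp hp = 𝟙 _ := (hWs i).hom_self hp
  have c_eq (i j : ι) {p q : Y} (hp : p ∈ W i) (hq : q ∈ W i) (hp' : p ∈ W j) (hq' : q ∈ W j) :
      c i hp hq = c j hp' hq' :=
    ((hWs i).hom_eq_of_subset (hWp i j ⟨p, hp, hp'⟩) Set.inter_subset_left
      ⟨hp, hp'⟩ ⟨hq, hq'⟩).trans
    ((hWs j).hom_eq_of_subset (hWp i j ⟨p, hp, hp'⟩) Set.inter_subset_right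
      ⟨hp, hp'⟩ ⟨hq, hq'⟩).symm
  -- Independence of `y` uses path connectedness of `W i ∩ W j`: there `c i` and `c j` agree. When
  -- the sets are disjoint the value is arbitrary.
  have exk (i j : ι) : ∃ k : FundamentalGroupoid.mk (p i) ⟶ FundamentalGroupoid.mk (p j),
      ∀ (y : Y) (hi : y ∈ W i) (hj : y ∈ W j), k = c i (hp i) hi ≫ c j hj (hp j) := by
    by_cases h : (W i ∩ W j).Nonempty
    · obtain ⟨z, hzi, hzj⟩ := h
      refine ⟨c i (hp i) hzi ≫ c j hzj (hp j), fun y hi hj => ?_⟩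
      rw [← c_comp i (hp i) hi hzi, ← c_comp j hzj hj (hp j), c_eq j i hzj hj hzi hi,
        Category.assoc, ← Category.assoc (c i hi hzi), c_comp, c_self, Category.id_comp]
    · exact ⟨(hpp i j).somePath.toHom, fun y hi hj => (h ⟨y, hi, hj⟩).elim⟩
  choose k hk using exk
  have k_comp (i j l : ι) (h : (A i ∩ A j ∩ A l).Nonempty) : k i j ≫ k j l = k i l := by
    obtain ⟨y, ⟨hi, hj⟩, hl⟩ := hAW i j l h
    rw [hk i j y hi hj, hk j l y hj hl, hk i l y hi hl, Category.assoc,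
      ← Category.assoc (c j hj _), c_comp, c_self, Category.id_comp]
  -- trivialization of the cocycle
  let b := FundamentalGroupoid.mk (p i₀)
  let e (i : ι) : b ⟶ FundamentalGroupoid.mk (p i) := (hpp i₀ i).somePath.toHom
  -- Multiplication in `End b` reverses `≫`; the opposite group restores the order of the cocycle
  -- identity.
  obtain ⟨h, hh⟩ := exists_coboundary_of_cocycle (Γ := (End b)ᵐᵒᵖ) A hAo hAp hA
    (fun i j => MulOpposite.op (End.of (e i ≫ k i j ≫ CategoryTheory.inv (e j)))) (by
      intro i j l hijl
      rw [← MulOpposite.op_mul, End.mul_def, ← k_comp i j l hijl]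
      simp [End.of])
  let d (i : ι) : b ⟶ FundamentalGroupoid.mk (p i) := End.asHom (h i).unop ≫ e i
  have hd (i j : ι) (hij : (A i ∩ A j).Nonempty) : d i ≫ k i j = d j := by
    change _ = End.asHom (h j).unop ≫ e j
    rw [← hh i j hij, MulOpposite.unop_mul, End.mul_def]
    simp [d, End.of, End.asHom]
  have exD (y : Y) : ∃ D : b ⟶ FundamentalGroupoid.mk y, ∀ (i : ι) (hi : y ∈ W i),
      D = d i ≫ c i (hp i) hi := by
    obtain ⟨i, hi⟩ := memW y
    refine ⟨d i ≫ c i (hp i) hi, fun j hj => ?_⟩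
    rw [← hd i j (hWA i j ⟨y, hi, hj⟩), hk i j y hi hj]
    simp only [Category.assoc, c_comp, c_self, Category.comp_id]
  choose D hD using exD
  have hloc (q : Y) : ∃ V ∈ nhds q, ∀ (a b : Y) (γ : Path a b), (∀ t, γ t ∈ V) →
      D a ≫ γ.toHom = D b := by
    obtain ⟨i, hi⟩ := memW q
    refine ⟨W i, (hWo i).mem_nhds hi, fun a b γ hγ => ?_⟩
    have ha : a ∈ W i := by simpa using hγ 0
    have hb : b ∈ W i := by simpa using hγ 1
    rw [hD a i ha, hD b i hb, ← (hWs i).hom_eq ha hb γ hγ, Category.assoc]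
    exact congrArg _ (c_comp i (hp i) ha hb)
  refine simply_connected_iff_paths_homotopic'.2 ⟨hY, fun {x y} γ γ' => ?_⟩
  refine Path.toHom_eq_iff.1 ((cancel_epi (D x)).1 ?_)
  rw [Path.comp_toHom_eq D hloc γ, Path.comp_toHom_eq D hloc γ']

/-! ### Open stars in the weak topology -/

namespace GeometricRealization

variable {ι : Type*} {K : PreAbstractSimplicialComplex ι}

theorem faceMap_coord_of_mem (τ : K.faces) (u : stdSimplex ℝ τ.1) {i : ι} (hi : i ∈ τ.1) :
    (faceMap K τ u).coord i = u.1 ⟨i, hi⟩ :=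
  Finsupp.embDomain_apply_self (Function.Embedding.subtype (· ∈ τ.1))
    (Finsupp.equivFunOnFinite.symm u.1) ⟨i, hi⟩

theorem faceMap_coord_of_notMem (τ : K.faces) (u : stdSimplex ℝ τ.1) {i : ι} (hi : i ∉ τ.1) :
    (faceMap K τ u).coord i = 0 := by
  refine Finsupp.embDomain_of_notMem_range _ _ _ ?_
  rintro ⟨j, rfl⟩
  exact hi j.2

theorem continuous_faceMap (τ : K.faces) : Continuous (faceMap K τ) :=
  continuous_iSup_rng continuous_coinduced_rng

theorem continuous_coord (i : ι) : Continuous fun x : GeometricRealization K => x.coord i := by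
  refine continuous_iSup_dom.2 fun τ => continuous_coinduced_dom.2 ?_
  by_cases hi : i ∈ τ.1
  · simp only [Function.comp_def, faceMap_coord_of_mem τ _ hi]
    exact (continuous_apply (⟨i, hi⟩ : τ.1)).comp continuous_subtype_val
  · simp only [Function.comp_def, faceMap_coord_of_notMem τ _ hi]
    fun_prop

theorem coord_pos_iff (x : GeometricRealization K) (i : ι) :
    0 < x.coord i ↔ i ∈ x.coord.support := by
  rw [Finsupp.mem_support_iff]
  exact (x.nonneg i).lt_iff_ne'

theorem sum_coord_of_subset (x : GeometricRealization K) {s : Finset ι}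
    (hs : x.coord.support ⊆ s) : ∑ i ∈ s, x.coord i = 1 := by
  rw [← x.sum_eq_one, Finsupp.sum_of_support_subset _ hs _ (fun _ _ => rfl)]

/-- The barycentric coordinates of a point in a simplex which contains its support. -/
def toSimplex (x : GeometricRealization K) (s : Finset ι) (hs : x.coord.support ⊆ s) :
    stdSimplex ℝ s :=
  ⟨fun i => x.coord i, fun i => x.nonneg i, by
    rw [Finset.sum_coe_sort s fun i => x.coord i, x.sum_coord_of_subset hs]⟩

theorem faceMap_toSimplex (x : GeometricRealization K) (τ : K.faces)
    (hs : x.coord.support ⊆ τ.1) : faceMap K τ (x.toSimplex τ.1 hs) = x := by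
  ext i
  by_cases hi : i ∈ τ.1
  · rw [faceMap_coord_of_mem τ _ hi]; rfl
  · rw [faceMap_coord_of_notMem τ _ hi]
    exact (Finsupp.notMem_support_iff.1 fun h => hi (hs h)).symm

/-- The disjoint union of the closed simplices maps onto the realization. -/
noncomputable def sigmaFaceMap (K : PreAbstractSimplicialComplex ι)
    (u : Σ τ : K.faces, stdSimplex ℝ τ.1) : GeometricRealization K :=
  faceMap K u.1 u.2

theorem isQuotientMap_sigmaFaceMap : Topology.IsQuotientMap (sigmaFaceMap K) := by
  refine ⟨Topology.isCoinducing_iff.2 fun s => ?_, fun x => ⟨⟨⟨_, x.support_mem⟩,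
    x.toSimplex _ subset_rfl⟩, faceMap_toSimplex x ⟨_, x.support_mem⟩ subset_rfl⟩⟩
  rw [isOpen_iff, isOpen_sigma_iff]
  rfl

/-- The open star of the simplex `σ`. -/
def openStar (K : PreAbstractSimplicialComplex ι) (σ : Finset ι) : Set (GeometricRealization K) :=
  {x | σ ⊆ x.coord.support}

theorem mem_openStar {σ : Finset ι} {x : GeometricRealization K} :
    x ∈ openStar K σ ↔ σ ⊆ x.coord.support :=
  Iff.rfl

theorem isOpen_openStar (σ : Finset ι) : IsOpen (openStar K σ) := by
  have : openStar K σ = ⋂ i ∈ σ, {x | 0 < x.coord i} := by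
    ext x
    simp [openStar, Finset.subset_iff, coord_pos_iff]
  rw [this]
  exact isOpen_biInter_finset fun i _ => isOpen_lt continuous_const (continuous_coord i)

/-- The segment from `u` to `v` in a standard simplex. -/
def stdSimplexSegment {s : Finset ι} (u v : stdSimplex ℝ s) (t : unitInterval) : stdSimplex ℝ s :=
  ⟨(1 - (t : ℝ)) • u.1 + (t : ℝ) • v.1,
    convex_stdSimplex ℝ s u.2 v.2 (sub_nonneg.2 t.2.2) t.2.1 (sub_add_cancel _ _)⟩

/-- The segment from `x` to `b`, in the case where the support of `x` contains that of `b`. -/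
noncomputable def segment (x b : GeometricRealization K)
    (h : x ∈ openStar K b.coord.support) (t : unitInterval) : GeometricRealization K :=
  faceMap K ⟨_, x.support_mem⟩
    (stdSimplexSegment (x.toSimplex _ subset_rfl) (b.toSimplex x.coord.support h) t)

theorem segment_coord (x b : GeometricRealization K)
    (h : x ∈ openStar K b.coord.support) (t : unitInterval) (i : ι) :
    (segment x b h t).coord i = (1 - (t : ℝ)) * x.coord i + t * b.coord i := by
  by_cases hi : i ∈ x.coord.support
  · rw [segment, faceMap_coord_of_mem _ _ hi]; rfl
  · rw [segment, faceMap_coord_of_notMem _ _ hi, Finsupp.notMem_support_iff.1 hi,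
      Finsupp.notMem_support_iff.1 fun hb => hi (h hb)]
    simp

/-- Lets the segment be computed in any one closed simplex containing `x`, as continuity in the weak
topology requires. -/
theorem faceMap_segment (x b : GeometricRealization K)
    (h : x ∈ openStar K b.coord.support)
    (τ : K.faces) (hx : x.coord.support ⊆ τ.1) (t : unitInterval) :
    faceMap K τ (stdSimplexSegment (x.toSimplex _ hx)
      (b.toSimplex _ (subset_trans (mem_openStar.1 h) hx)) t) =
      segment x b h t := by
  ext i
  rw [segment_coord]
  by_cases hi : i ∈ τ.1
  · rw [faceMap_coord_of_mem _ _ hi]; rfl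
  · rw [faceMap_coord_of_notMem _ _ hi, Finsupp.notMem_support_iff.1 fun hb => hi (hx hb),
      Finsupp.notMem_support_iff.1 fun hb => hi (hx (h hb))]
    simp

theorem support_faceMap_subset (τ : K.faces) (u : stdSimplex ℝ τ.1) :
    (faceMap K τ u).coord.support ⊆ τ.1 := by
  intro i hi
  by_contra h
  exact Finsupp.mem_support_iff.1 hi (faceMap_coord_of_notMem τ u h)

theorem toSimplex_faceMap (τ : K.faces) (u : stdSimplex ℝ τ.1) :
    (faceMap K τ u).toSimplex τ.1 (support_faceMap_subset τ u) = u := by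
  ext i
  exact faceMap_coord_of_mem τ u i.2

/-- Joint continuity can be tested on closed simplices: the quotient map from their disjoint union
stays a quotient map over the open star, and also after taking the product with the locally compact
unit interval. -/
theorem continuous_segment (b : GeometricRealization K) :
    Continuous fun z : openStar K b.coord.support × unitInterval => segment z.1.1 b z.1.2 z.2 := by
  classical
  refine ((isQuotientMap_sigmaFaceMap (K := K)).restrictPreimage_isOpen
    (isOpen_openStar b.coord.support)).continuous_lift_prod_left ?_
  let F (τ : K.faces) : C(stdSimplex ℝ τ.1, C(unitInterval, GeometricRealization K)) :=
    if h : b.coord.support ⊆ τ.1 then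
      ContinuousMap.curry ⟨fun z => faceMap K τ (stdSimplexSegment z.1 (b.toSimplex _ h) z.2),
        (continuous_faceMap τ).comp (by unfold stdSimplexSegment; fun_prop)⟩
    -- A dummy value: such a simplex does not meet the open star.
    else ContinuousMap.curry ⟨fun z => faceMap K τ z.1, by
        exact (continuous_faceMap τ).comp continuous_fst⟩
  have hF : Continuous fun u : Σ τ : K.faces, stdSimplex ℝ τ.1 => F u.1 u.2 :=
    continuous_sigma fun τ => (F τ).continuous
  have hG : Continuous fun z : (sigmaFaceMap K ⁻¹' openStar K b.coord.support) × unitInterval =>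
      F z.1.1.1 z.1.1.2 z.2 :=
    ContinuousEval.continuous_eval.comp
      (((hF.comp continuous_subtype_val).comp continuous_fst).prodMk continuous_snd)
  refine hG.congr ?_
  rintro ⟨⟨⟨τ, u⟩, hu⟩, t⟩
  have hu' : b.coord.support ⊆ (faceMap K τ u).coord.support := hu
  have hb := hu'.trans (support_faceMap_subset τ u)
  simp only [F, dif_pos hb]
  have := faceMap_segment (faceMap K τ u) b hu' τ (support_faceMap_subset τ u) t
  rwa [toSimplex_faceMap] at this

theorem exists_support_eq (σ : Finset ι) (hσ : σ ∈ K.faces) :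
    ∃ b : GeometricRealization K, b.coord.support = σ := by
  have : Nonempty σ := ((K.isRelLowerSet_faces hσ).1).to_subtype
  refine ⟨faceMap K ⟨σ, hσ⟩ stdSimplex.barycenter,
    (support_faceMap_subset _ _).antisymm fun i hi => ?_⟩
  rw [Finsupp.mem_support_iff, faceMap_coord_of_mem ⟨σ, hσ⟩ _ hi, stdSimplex.barycenter_apply]
  exact inv_ne_zero (Nat.cast_ne_zero.2 Fintype.card_ne_zero)

/-- Contract along segments to a point `b` with support exactly `σ`; coordinates in `σ` stay
positive, so the segments remain in the star. -/
theorem contractibleSpace_openStar {σ : Finset ι} (hσ : σ ∈ K.faces) :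
    ContractibleSpace (openStar K σ) := by
  obtain ⟨b, rfl⟩ := exists_support_eq σ hσ
  rw [contractible_iff_id_nullhomotopic]
  have hmem (x : openStar K b.coord.support) (t : unitInterval) :
      segment x.1 b x.2 t ∈ openStar K b.coord.support := fun i hi => by
    rw [← coord_pos_iff] at hi ⊢
    have hx := (coord_pos_iff x.1 i).2 (x.2 ((coord_pos_iff b i).1 hi))
    rw [segment_coord]
    rcases t.2.1.eq_or_lt with h | h
    · rw [← h]; simpa using hx
    · exact add_pos_of_nonneg_of_pos (mul_nonneg (sub_nonneg.2 t.2.2) hx.le) (mul_pos h hi)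
  refine ⟨⟨b, mem_openStar.2 subset_rfl⟩, ⟨⟨⟨fun z => ⟨segment z.2.1 b z.2.2 z.1, hmem _ _⟩, ?_⟩, ?_, ?_⟩⟩⟩
  · exact ((continuous_segment b).comp continuous_swap).subtype_mk _
  · intro x
    ext i
    simp [segment_coord]
  · intro x
    ext i
    simp [segment_coord]

theorem isSimplyConnected_openStar {σ : Finset ι} (hσ : σ ∈ K.faces) :
    IsSimplyConnected (openStar K σ) :=
  have := contractibleSpace_openStar hσ
  SimplyConnectedSpace.ofContractible _

theorem openStar_inter_openStar [DecidableEq ι] (σ τ : Finset ι) :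
    openStar K σ ∩ openStar K τ = openStar K (σ ∪ τ) := by
  ext x
  exact Finset.union_subset_iff.symm

theorem openStar_nonempty_iff {σ : Finset ι} (hσ : σ.Nonempty) :
    (openStar K σ).Nonempty ↔ σ ∈ K.faces := by
  refine ⟨fun ⟨x, hx⟩ => (K.isRelLowerSet_faces x.support_mem).2 hx hσ, fun h => ?_⟩
  obtain ⟨b, hb⟩ := exists_support_eq σ h
  exact ⟨b, hb.ge⟩

theorem iUnion_openStar_singleton : ⋃ i, openStar K {i} = Set.univ := by
  refine Set.eq_univ_of_forall fun x => ?_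
  obtain ⟨i, hi⟩ := (K.isRelLowerSet_faces x.support_mem).1
  exact Set.mem_iUnion.2 ⟨i, Finset.singleton_subset_iff.2 hi⟩

end GeometricRealization

/-! ### The nerve of a covering -/

open GeometricRealization in
/-- The nerve of an open covering of a simply connected space by path connected sets is simply
connected. -/
theorem simplyConnectedSpace_coverNerve {ι X : Type*} [TopologicalSpace X] [SimplyConnectedSpace X]
    (A : ι → Set X) (hAo : ∀ i, IsOpen (A i)) (hAp : ∀ i, IsPathConnected (A i))
    (hA : ⋃ i, A i = Set.univ) : SimplyConnectedSpace (GeometricRealization (coverNerve A)) := by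
  classical
  have hmem (σ : Finset ι) (hσ : σ.Nonempty) :
      (openStar (coverNerve A) σ).Nonempty ↔ (⋂ i ∈ σ, A i).Nonempty :=
    (openStar_nonempty_iff hσ).trans ⟨fun h => h.2, fun h => ⟨hσ, h⟩⟩
  refine simplyConnectedSpace_of_cover A (fun i => openStar (coverNerve A) {i}) hAo hAp hA
    (fun i => isOpen_openStar _)
    (fun i => isSimplyConnected_openStar (singleton_mem_coverNerve A (fun i => (hAp i).nonempty) i))
    iUnion_openStar_singleton ?_ ?_ ?_
  · intro i j h
    rw [openStar_inter_openStar] at h ⊢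
    exact (isSimplyConnected_openStar ((openStar_nonempty_iff (by simp)).1 h)).isPathConnected
  · intro i j k h
    rw [openStar_inter_openStar, openStar_inter_openStar, hmem _ (by simp)]
    refine h.mono fun x hx => ?_
    simpa [and_assoc, and_left_comm, and_comm] using hx
  · intro i j h
    rw [openStar_inter_openStar, hmem _ (by simp)] at h
    refine h.mono fun x hx => ?_
    simpa [and_comm] using hx

/-- The action serves only to make all translates of `U` open and path connected. -/
theorem proposition1p8 {G X : Type*} [Group G] [TopologicalSpace X] [MulAction G X]
    [ContinuousConstSMul G X] [SimplyConnectedSpace X]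
    (U : Set X) (hUopen : IsOpen U) (hUpath : IsPathConnected U)
    (hcover : (⋃ g : G, g • U) = Set.univ) :
    SimplyConnectedSpace (GeometricRealization (coverNerve fun g : G => g • U)) :=
  simplyConnectedSpace_coverNerve (fun g : G => g • U) (fun g => hUopen.smul g)
    (fun g => hUpath.image (continuous_const_smul g)) hcover
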